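/- Let $\mathcal A=\{\mathbf a_1,\dots,\mathbf a_n\}\subset\mathbb Z^d$ be the columns of an integer $d\times n$ matrix $A$ of rank $d$, let $\mathcal L_{\mathcal A}=\{\mathbf u\in\mathbb Z^n : A\mathbf u=0\}$, and assume $\mathcal L_{\mathcal A}\cap\mathbb N^n=\{0\}$. Let $\mathbf k$ be an algebraically closed field and $\mathbf k[\mathbf x]=\mathbf k[x_1,\dots,x_n]$. For $\mathbf u\in\mathbb Z^n$ write $\mathbf u=\mathbf u^+-\mathbf u^-$ with $u_j^+=\max(u_j,0)$ and $u_j^-=\max(-u_j,0)$, and $\operatorname{supp}(\mathbf u)=\{j : u_j\ne 0\}$. A circuit of $\mathcal A$ is a nonzero vector $\mathbf c\in\mathcal L_{\mathcal A}$ whose components have greatest common divisor one and for which there is no nonzero $\mathbf e\in\mathcal L_{\mathcal A}$ with $\operatorname{supp}(\mathbf e)\subsetneq\operatorname{supp}(\mathbf c)$. The circuit ideal and the toric ideal are $$I_{\mathcal C_{\mathcal A}}=\langle \mathbf x^{\mathbf c^+}-\mathbf x^{\mathbf c^-} : \mathbf c \text{ a circuit of }\mathcal A\rangle,\qquad I_{\mathcal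 A}=\langle \mathbf x^{\mathbf u^+}-\mathbf x^{\mathbf u^-} : \mathbf u\in\mathcal L_{\mathcal A}\rangle .$$ For $\omega\in\mathbb R^n$ and an ideal $I$ of $\mathbf k[\mathbf x]$, the initial ideal $\operatorname{in}_\omega(I)$ is generated by the initial forms $\operatorname{in}_\omega(f)$, $f\in I$, where $\operatorname{in}_\omega(f)$ is the sum of the terms of $f$ whose exponent $\mathbf u$ has maximal weight $\omega\cdot\mathbf u$. Let $\omega\in\mathbb R^n$ be generic in the sense that $\operatorname{in}_\omega(I_{\mathcal A})$ and $\operatorname{in}_\omega(I_{\mathcal C_{\mathcal A}})$ are both monomial ideals. Let $\Delta_\omega$ be the regular triangulation of $\mathcal A$: a set $\sigma\subseteq[n]=\{1,\dots,n\}$ is a face of $\Delta_\omega$ if and only if there is $\mathbf c\in\mathbb R^d$ with $\mathbf a_j\cdot\mathbf c=\omega_j$ for $j\in\sigma$ and $\mathbf a_j\cdot\mathbf c<\omega_j$ for $j\notin\sigma$. For $\sigma\subseteq[n]$ put $P_\sigma=\langle x_j : j\notin\sigma\rangle$. Then: 1. Every associated prime of $\operatorname{in}_\omega(I_{\mathcal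 C_{\mathcal A}})$ is of the form $P_\sigma$ with $\sigma$ a face of $\Delta_\omega$. 2. For $\sigma\subseteq[n]$, the prime $P_\sigma$ is a minimal prime of $\operatorname{in}_\omega(I_{\mathcal C_{\mathcal A}})$ if and only if $\sigma$ is a maximal face of $\Delta_\omega$. 3. The ideal $\operatorname{in}_\omega(I_{\mathcal C_{\mathcal A}})$ is equidimensional: $\mathbf k[\mathbf x]/P$ has the same Krull dimension for all its minimal primes $P$. -/

import Mathlib

namespace CircuitIdeal

/-- The saturated lattice `{u ∈ ℤⁿ : A u = 0}`. -/
def lattice {d n : ℕ} (A : Matrix (Fin d) (Fin n) ℤ) : Submodule ℤ (Fin n → ℤ) :=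
  LinearMap.ker A.mulVecLin

/-- A circuit of `A`: a nonzero primitive vector of the lattice such that no nonzero vector of
the lattice has strictly smaller support. -/
def IsCircuit {d n : ℕ} (A : Matrix (Fin d) (Fin n) ℤ) (c : Fin n → ℤ) : Prop :=
  c ∈ lattice A ∧ c ≠ 0 ∧ Finset.univ.gcd c = 1 ∧
    ¬ ∃ e ∈ lattice A, e ≠ 0 ∧ Function.support e ⊂ Function.support c

/-- The exponent vector `u⁺`, with `u⁺ⱼ = max (uⱼ, 0)`; then `u⁻ = (-u)⁺`. -/
noncomputable def posPart {n : ℕ} (u : Fin n → ℤ) : Fin n →₀ ℕ :=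
  Finsupp.equivFunOnFinite.symm fun j => (u j).toNat

/-- The binomial `x^{u⁺} - x^{u⁻}`. -/
noncomputable def binomial (k : Type*) [Field k] {n : ℕ} (u : Fin n → ℤ) :
    MvPolynomial (Fin n) k :=
  MvPolynomial.monomial (posPart u) 1 - MvPolynomial.monomial (posPart (-u)) 1

/-- The toric ideal of `A`, generated by the binomials of all lattice vectors. -/
noncomputable def toricIdeal (k : Type*) [Field k] {d n : ℕ} (A : Matrix (Fin d) (Fin n) ℤ) :
    Ideal (MvPolynomial (Fin n) k) :=
  Ideal.span (binomial k '' {u | u ∈ lattice A})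

/-- The circuit ideal of `A`, generated by the binomials of all circuits. -/
noncomputable def circuitIdeal (k : Type*) [Field k] {d n : ℕ} (A : Matrix (Fin d) (Fin n) ℤ) :
    Ideal (MvPolynomial (Fin n) k) :=
  Ideal.span (binomial k '' {c | IsCircuit A c})

open Classical in
/-- The initial form of `f`: the sum of the terms `f_u x^u` of `f` whose weight `ω · u` is maximal
among the terms of `f`. -/
noncomputable def initialForm {k : Type*} [Field k] {n : ℕ} (ω : Fin n → ℝ)
    (f : MvPolynomial (Fin n) k) : MvPolynomial (Fin n) k :=
  ∑ u ∈ f.support with ∀ v ∈ f.support, Finsupp.weight ω v ≤ Finsupp.weight ω u,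
    MvPolynomial.monomial u (f.coeff u)

/-- The initial ideal of `I` with respect to `ω`, generated by the initial forms of all elements
of `I`. -/
noncomputable def initialIdeal {k : Type*} [Field k] {n : ℕ} (ω : Fin n → ℝ)
    (I : Ideal (MvPolynomial (Fin n) k)) : Ideal (MvPolynomial (Fin n) k) :=
  Ideal.span (initialForm ω '' {f | f ∈ I})

/-- An ideal generated by monomials. -/
def IsMonomialIdeal {k : Type*} [Field k] {n : ℕ} (I : Ideal (MvPolynomial (Fin n) k)) : Prop :=
  ∃ S : Set (Fin n →₀ ℕ), I = Ideal.span ((fun u => MvPolynomial.monomial u (1 : k)) '' S)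

/-- The weight vector `ω` is generic for `A` over `k`: the initial ideals of the toric ideal and of
the circuit ideal with respect to `ω` are both monomial ideals. -/
def IsGeneric (k : Type*) [Field k] {d n : ℕ} (A : Matrix (Fin d) (Fin n) ℤ)
    (ω : Fin n → ℝ) : Prop :=
  IsMonomialIdeal (initialIdeal ω (toricIdeal k A)) ∧
    IsMonomialIdeal (initialIdeal ω (circuitIdeal k A))

/-- The set of faces of the regular triangulation `Δ_ω` of the columns `a₁, …, aₙ` of `A`: `σ` is a
face iff there is `c ∈ ℝᵈ` with `aⱼ · c = ωⱼ` for `j ∈ σ` and `aⱼ · c < ωⱼ` for `j ∉ σ`. -/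
def regularTriangulation {d n : ℕ} (A : Matrix (Fin d) (Fin n) ℤ) (ω : Fin n → ℝ) :
    Set (Finset (Fin n)) :=
  {σ | ∃ c : Fin d → ℝ, ∀ j, (j ∈ σ → ∑ i, (A i j : ℝ) * c i = ω j) ∧
    (j ∉ σ → ∑ i, (A i j : ℝ) * c i < ω j)}

/-- The monomial prime `P_σ = ⟨xⱼ : j ∉ σ⟩`. -/
noncomputable def facePrime (k : Type*) [Field k] {n : ℕ} (σ : Finset (Fin n)) :
    Ideal (MvPolynomial (Fin n) k) :=
  Ideal.span (MvPolynomial.X '' {j | j ∉ σ})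

/-- An ideal `I` of `R` is equidimensional if `R ⧸ P` has the same Krull dimension for all minimal
primes `P` of `I`. -/
def IsEquidimensional {R : Type*} [CommRing R] (I : Ideal R) : Prop :=
  ∀ P ∈ I.minimalPrimes, ∀ Q ∈ I.minimalPrimes, ringKrullDim (R ⧸ P) = ringKrullDim (R ⧸ Q)

end CircuitIdeal

/-! Every prime over a monomial ideal contains a monomial prime over it, and associated primes of
monomial ideals are monomial. Everything thus reduces to `initialIdeal_le_facePrime_iff`: `P_σ`
contains the initial ideal of the circuit ideal exactly when `σ` is a face.

If `σ` is not a face, convex separation gives a kernel vector of nonpositive weight, nonnegative off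
`σ`; one of minimal support is a multiple of a circuit `c` (`exists_circuit_of_not_face`). Then
`x^{c⁻}` lies in the initial ideal and involves only variables of `σ`. Conversely, even the initial
ideal of the larger toric ideal has no monomial supported on a face: the map `x_j ↦ t^{a_j}` on `σ`,
`x_j ↦ 0` off `σ`, kills it (`faceHom_eq_zero_of_mem_initialIdeal`).

Since `σ ↦ P_σ` reverses inclusions, minimal primes match maximal faces. Columns of a face are
independent because the toric initial ideal is monomial, and a face with fewer than `d` elements can
be enlarged. So all maximal faces have `d` elements, and the quotients by their primes are
isomorphic. -/

namespace CircuitIdeal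

/-! ### Convexity: from non-faces to circuits -/

/-- A real solution of an integer linear system yields an integer solution of smaller support. -/
theorem exists_int_solution {ι κ : Type*} [Fintype κ] (M : ι → κ → ℤ) (u : κ → ℝ) (hu : u ≠ 0)
    (h : ∀ i, ∑ j, (M i j : ℝ) * u j = 0) :
    ∃ e : κ → ℤ, e ≠ 0 ∧ (∀ i, ∑ j, M i j * e j = 0) ∧ ∀ j, u j = 0 → e j = 0 := by
  obtain ⟨j₀, hj₀⟩ : ∃ j, u j ≠ 0 := by
    by_contra! hc
    exact hu (funext hc)
  -- A `ℚ`-linear functional applied entrywise preserves integer relations and zeros; clearing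
  -- denominators then gives `e`.
  obtain ⟨f, hf⟩ : ∃ f : Module.Dual ℚ ℝ, f (u j₀) ≠ 0 := by
    by_contra! hc
    exact hj₀ ((Module.forall_dual_apply_eq_zero_iff ℚ (u j₀)).1 hc)
  obtain ⟨⟨b, hb⟩, hbv⟩ :=
    IsLocalization.exist_integer_multiples_of_finite (nonZeroDivisors ℤ) fun j => f (u j)
  choose e he using hbv
  have he' : ∀ j, (e j : ℚ) = b * f (u j) := fun j => by
    simpa [Algebra.smul_def] using he j
  have hb0 : (b : ℚ) ≠ 0 := by exact_mod_cast nonZeroDivisors.ne_zero hb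
  refine ⟨e, fun h0 => ?_, fun i => ?_, fun j hj => ?_⟩
  · have := he' j₀
    rw [h0] at this
    simp [hb0, hf] at this
  · have h1 : ∑ j, (M i j : ℚ) * f (u j) = 0 := by
      have h2 := congrArg f (h i)
      rw [map_sum, map_zero] at h2
      rw [← h2]
      refine Finset.sum_congr rfl fun j _ => ?_
      rw [← zsmul_eq_mul, ← zsmul_eq_mul, map_zsmul]
    have h3 : ((∑ j, M i j * e j : ℤ) : ℚ) = 0 := by
      push_cast
      simp_rw [he', mul_left_comm _ (b : ℚ), ← Finset.mul_sum, h1, mul_zero]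
    exact_mod_cast h3
  · have := he' j
    rw [hj] at this
    simpa using this

/-- A nonempty convex set avoiding the origin lies in a closed half-space through the origin. -/
theorem exists_linear_nonneg_of_convex {E : Type*} [NormedAddCommGroup E] [NormedSpace ℝ E]
    [FiniteDimensional ℝ E] {s : Set E} (hs : Convex ℝ s) (hne : s.Nonempty) (h0 : (0 : E) ∉ s) :
    ∃ f : E →ₗ[ℝ] ℝ, f ≠ 0 ∧ ∀ x ∈ s, 0 ≤ f x := by
  by_cases hint : (interior s).Nonempty
  · obtain ⟨f, hf0, hf⟩ := geometric_hahn_banach_of_nonempty_interior_point hs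
      (fun h => h0 (interior_subset h)) hint
    refine ⟨-f.toLinearMap, fun h => hf0 ?_, fun x hx => ?_⟩
    · ext x
      simpa using LinearMap.congr_fun h x
    · simpa using hf x hx
  -- With empty interior the affine span is proper; a functional killing its direction is constant
  -- on `s`, and its sign can be chosen.
  · rw [hs.interior_nonempty_iff_affineSpan_eq_top,
      ← AffineSubspace.direction_eq_top_iff_of_nonempty ((affineSpan_nonempty ℝ).2 hne),
      ← Ne, ← lt_top_iff_ne_top] at hint
    obtain ⟨f, hf, hker⟩ := Submodule.exists_le_ker_of_lt_top _ hint
    obtain ⟨x₀, hx₀⟩ := hne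
    have hconst : ∀ x ∈ s, f x = f x₀ := fun x hx => by
      have := hker (AffineSubspace.vsub_mem_direction (mem_affineSpan ℝ hx) (mem_affineSpan ℝ hx₀))
      rw [LinearMap.mem_ker, vsub_eq_sub, map_sub] at this
      linarith
    rcases le_total 0 (f x₀) with h | h
    · exact ⟨f, hf, fun x hx => (hconst x hx).symm ▸ h⟩
    · refine ⟨-f, neg_ne_zero.2 hf, fun x hx => ?_⟩
      rw [LinearMap.neg_apply, hconst x hx]
      linarith

/-- Let `r` tend to `0` and to infinity. This turns inequalities along rays into sign conditions on
the separating functional. -/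
theorem nonneg_of_forall_pos_add_mul {K z : ℝ} (h : ∀ r : ℝ, 0 < r → 0 ≤ K + r * z) :
    0 ≤ K ∧ 0 ≤ z := by
  constructor
  · by_contra! hK
    have h1 := h (-K / (2 * (|z| + 1))) (by have := abs_nonneg z; apply div_pos <;> linarith)
    have h2 : -K / (2 * (|z| + 1)) * z ≤ -K / 2 := by
      rw [div_mul_eq_mul_div, div_le_div_iff₀ (by positivity) (by norm_num)]
      nlinarith [le_abs_self z]
    linarith
  · by_contra! hz
    have h1 := h ((|K| + 1) / -z) (div_pos (by positivity) (by linarith))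
    have h2 : (|K| + 1) / -z * z = -(|K| + 1) := by
      rw [div_neg, neg_mul, div_mul_cancel₀ _ hz.ne]
    linarith [le_abs_self K]

variable {d n : ℕ} (A : Matrix (Fin d) (Fin n) ℤ) (ω : Fin n → ℝ)

open scoped Pointwise in
/-- If `σ` is not a face, then there is a real vector in the kernel of `A` which is nonnegative off
`σ` and has nonpositive weight. -/
theorem exists_real_of_not_face {σ : Finset (Fin n)} (hσ : σ ∉ regularTriangulation A ω) :
    ∃ u : Fin n → ℝ, u ≠ 0 ∧ (∀ i, ∑ j, (A i j : ℝ) * u j = 0) ∧ (∀ j ∉ σ, 0 ≤ u j) ∧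
      ∑ j, ω j * u j ≤ 0 := by
  let L : (Fin d → ℝ) →ₗ[ℝ] (Fin n → ℝ) := ((A.map (Int.cast : ℤ → ℝ)).transpose).mulVecLin
  have hL : ∀ c j, L c j = ∑ i, (A i j : ℝ) * c i := fun c j => by
    simp [L, Matrix.vecMul, dotProduct, mul_comm]
  let B : Set (Fin n → ℝ) := Set.univ.pi fun j => if j ∈ σ then {0} else Set.Ioi 0
  have hB : ∀ t, t ∈ B ↔ ∀ j, (j ∈ σ → t j = 0) ∧ (j ∉ σ → 0 < t j) := fun t => by
    simp only [B, Set.mem_univ_pi]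
    refine forall_congr' fun j => ?_
    by_cases hj : j ∈ σ <;> simp [hj]
  have hBc : Convex ℝ B := convex_pi fun j _ => by
    by_cases hj : j ∈ σ
    · simp [hj]
    · simpa [hj] using convex_Ioi (0 : ℝ)
  -- `B` holds the admissible slacks, so `0 ∈ s` would say `L c + t = ω` with `t ∈ B`, making `σ` a
  -- face.
  let s : Set (Fin n → ℝ) := ((LinearMap.range L : Set (Fin n → ℝ)) + {-ω}) + B
  have hs : Convex ℝ s := ((LinearMap.range L).convex.add (convex_singleton _)).add hBc
  have hmem : ∀ c, ∀ t ∈ B, L c + -ω + t ∈ s := fun c t ht =>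
    Set.add_mem_add (Set.add_mem_add ⟨c, rfl⟩ rfl) ht
  have h0 : (0 : Fin n → ℝ) ∉ s := by
    rintro ⟨_, ⟨_, ⟨c, rfl⟩, _, rfl, rfl⟩, t, ht, h⟩
    refine hσ ⟨c, fun j => ?_⟩
    have h1 := congrFun h j
    simp only [Pi.add_apply, Pi.neg_apply, Pi.zero_apply, hL] at h1
    have h2 := (hB t).1 ht j
    exact ⟨fun hj => by linarith [h2.1 hj], fun hj => by linarith [h2.2 hj]⟩
  let t₀ : Fin n → ℝ := fun j => if j ∈ σ then 0 else 1
  have ht₀ : t₀ ∈ B := (hB _).2 fun j => ⟨fun hj => by simp [t₀, hj], fun hj => by simp [t₀, hj]⟩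
  obtain ⟨f, hf, hfs⟩ := exists_linear_nonneg_of_convex hs ⟨_, hmem 0 t₀ ht₀⟩ h0
  have hineq : ∀ c, ∀ t ∈ B, 0 ≤ f (L c) - f ω + f t := fun c t ht => by
    have := hfs _ (hmem c t ht)
    rw [map_add, map_add, map_neg] at this
    linarith
  have hfL' : ∀ c, 0 ≤ f (L c) := fun c =>
    (nonneg_of_forall_pos_add_mul (K := -f ω + f t₀) fun r _ => by
      have := hineq (r • c) t₀ ht₀
      rw [map_smul, map_smul, smul_eq_mul] at this
      linarith).2
  have hfL : ∀ c, f (L c) = 0 := fun c => le_antisymm (by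
    have := hfL' (-c)
    rw [map_neg, map_neg] at this
    linarith) (hfL' c)
  have hω : 0 ≤ -f ω := (nonneg_of_forall_pos_add_mul (z := f t₀) fun r hr => by
    have := hineq 0 (r • t₀) ((hB _).2 fun j => ⟨fun hj => by simp [t₀, hj],
      fun hj => by simpa [t₀, hj] using hr⟩)
    rw [hfL, map_smul, smul_eq_mul] at this
    linarith).1
  have hpos : ∀ j ∉ σ, 0 ≤ f (Pi.single j 1) := fun j hj =>
    (nonneg_of_forall_pos_add_mul (K := -f ω + f t₀) fun r hr => by
      have := hineq 0 (t₀ + r • Pi.single j 1) ((hB _).2 fun i => ⟨fun hi => by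
        have : i ≠ j := fun h => hj (h ▸ hi)
        simp [t₀, hi, this], fun hi => by
          have : 0 ≤ (Pi.single j 1 : Fin n → ℝ) i := by
            by_cases h : i = j
            · subst h; simp
            · simp [h]
          simp only [t₀, Pi.add_apply, Pi.smul_apply, smul_eq_mul, hi, if_false]
          positivity⟩)
      rw [hfL, map_add, map_smul, smul_eq_mul] at this
      linarith).2
  have hfu : ∀ x, f x = ∑ j, x j * f (Pi.single j 1) := fun x => by
    conv_lhs => rw [pi_eq_sum_univ' x]
    simp [map_sum]
  -- `u` is the coordinate vector of `f`; vanishing on the range of the transpose of `A` means `A u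
  -- = 0`.
  refine ⟨fun j => f (Pi.single j 1), fun h => hf ?_, fun i => ?_, hpos, ?_⟩
  · ext j
    simpa using congrFun h j
  · have := hfL (Pi.single i 1)
    rw [hfu] at this
    simpa [hL, Pi.single_apply] using this
  · rw [← hfu]
    linarith

/-- If `σ` is not a face, then there is a circuit of nonpositive weight which is nonnegative off
`σ`. -/
theorem exists_circuit_of_not_face {σ : Finset (Fin n)} (hσ : σ ∉ regularTriangulation A ω) :
    ∃ c, IsCircuit A c ∧ (∀ j ∉ σ, 0 ≤ c j) ∧ ∑ j, ω j * (c j : ℝ) ≤ 0 := by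
  classical
  let p : (Fin n → ℝ) → Prop := fun u => u ≠ 0 ∧ (∀ i, ∑ j, (A i j : ℝ) * u j = 0) ∧
    (∀ j ∉ σ, 0 ≤ u j) ∧ ∑ j, ω j * u j ≤ 0
  let N : (Fin n → ℝ) → ℕ := fun u => (Finset.univ.filter fun j => u j ≠ 0).card
  obtain ⟨u, ⟨hu0, hAu, hpos, hωu⟩, hmin⟩ : ∃ u, p u ∧ ∀ v, p v → N u ≤ N v := by
    have hex : ∃ m, ∃ u, p u ∧ N u = m :=
      let ⟨u, hu⟩ := exists_real_of_not_face A ω hσ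
      ⟨_, u, hu, rfl⟩
    obtain ⟨u, hu, hN⟩ := Nat.find_spec hex
    exact ⟨u, hu, fun v hv => hN ▸ Nat.find_min' hex ⟨v, hv, rfl⟩⟩
  have hNlt : ∀ v : Fin n → ℝ, (∀ j, u j = 0 → v j = 0) → (∃ j, u j ≠ 0 ∧ v j = 0) →
      ¬ p v := fun v h1 ⟨j, h2, h3⟩ hv => by
    refine (hmin v hv).not_gt (Finset.card_lt_card ⟨fun i hi => ?_, fun h => ?_⟩)
    · simp only [Finset.mem_filter, Finset.mem_univ, true_and] at hi ⊢
      exact fun h => hi (h1 i h)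
    · have := h (show j ∈ _ by simpa using h2)
      simp [h3] at this
  -- the support of `u` is minimal among all real kernel vectors
  have helem' : ∀ e : Fin n → ℝ, (∀ i, ∑ j, (A i j : ℝ) * e j = 0) → (∀ j, u j = 0 → e j = 0) →
      (∃ j, u j ≠ 0 ∧ e j = 0) → ∑ j, ω j * e j ≤ 0 → e = 0 := by
    intro e hAe hsupp ⟨j₀, hj₀, hej₀⟩ hωe
    by_contra he0
    by_cases hneg : ∃ j, j ∉ σ ∧ e j < 0
    · obtain ⟨j₁, hj₁, hle⟩ := (Finset.univ.filter fun j => j ∉ σ ∧ e j < 0).exists_min_image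
        (fun j => u j / -e j) (let ⟨j, hj⟩ := hneg; ⟨j, by simpa using hj⟩)
      simp only [Finset.mem_filter, Finset.mem_univ, true_and] at hj₁ hle
      -- Ratio test: moving from `u` along `e`, this is when an entry off `σ` first vanishes. Entry
      -- `j₀` survives, so the result is a nonzero competitor of smaller support.
      set t := u j₁ / -e j₁ with ht
      have ht0 : 0 ≤ t := div_nonneg (hpos _ hj₁.1) (by linarith [hj₁.2])
      have hz : u j₁ + t * e j₁ = 0 := by
        have := hj₁.2.ne
        rw [ht]
        field_simp
        ring
      refine hNlt (fun j => u j + t * e j) (fun j hj => by simp [hj, hsupp j hj])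
        ⟨j₁, fun h => hj₁.2.ne (hsupp _ h), hz⟩ ⟨fun h => hj₀ ?_, fun i => ?_, fun j hj => ?_, ?_⟩
      · simpa [hej₀] using congrFun h j₀
      · simp_rw [mul_add, Finset.sum_add_distrib, mul_left_comm _ t, ← Finset.mul_sum, hAu, hAe]
        simp
      · rcases lt_or_ge (e j) 0 with h | h
        · have := hle j ⟨hj, h⟩
          rw [le_div_iff₀ (by linarith)] at this
          linarith
        · have := hpos j hj
          positivity
      · simp_rw [mul_add, Finset.sum_add_distrib, mul_left_comm _ t, ← Finset.mul_sum]
        nlinarith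
    · push Not at hneg
      exact hNlt e hsupp ⟨j₀, hj₀, hej₀⟩ ⟨he0, hAe, hneg, hωe⟩
  have helem : ∀ e : Fin n → ℝ, (∀ i, ∑ j, (A i j : ℝ) * e j = 0) → (∀ j, u j = 0 → e j = 0) →
      (∃ j, u j ≠ 0 ∧ e j = 0) → e = 0 := by
    intro e hAe hsupp hj
    rcases le_total (∑ j, ω j * e j) 0 with h | h
    · exact helem' e hAe hsupp hj h
    · refine neg_eq_zero.1 (helem' (-e) (fun i => ?_) (fun j hj => ?_) ?_ ?_)
      · simp [hAe]
      · simp [hsupp j hj]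
      · simpa using hj
      · simpa using h
  obtain ⟨e, he0, hAe, hsupp⟩ := exists_int_solution A u hu0 hAu
  obtain ⟨j₀, hj₀⟩ : ∃ j, e j ≠ 0 := by
    by_contra! hc
    exact he0 (funext hc)
  obtain ⟨g, hg, hg1⟩ := Finset.univ.extract_gcd e ⟨j₀, Finset.mem_univ _⟩
  simp only [Finset.mem_univ, true_implies] at hg
  set D := Finset.univ.gcd e with hD
  have hD0 : D ≠ 0 := fun h => hj₀ (by rw [hg, h, zero_mul])
  have hgA : ∀ i, ∑ j, A i j * g j = 0 := fun i => by
    have := hAe i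
    simp_rw [hg, mul_left_comm _ D, ← Finset.mul_sum] at this
    exact (mul_eq_zero.1 this).resolve_left hD0
  have hgsupp : ∀ j, u j = 0 → g j = 0 := fun j hj => by
    have := hsupp j hj
    rw [hg] at this
    exact (mul_eq_zero.1 this).resolve_left hD0
  have hgj₀ : g j₀ ≠ 0 := fun h => hj₀ (by rw [hg, h, mul_zero])
  have hgAR : ∀ i, ∑ j, (A i j : ℝ) * (g j : ℝ) = 0 := fun i => by exact_mod_cast hgA i
  have huj₀ : u j₀ ≠ 0 := fun h => hgj₀ (hgsupp _ h)
  have hgj₀R : (g j₀ : ℝ) ≠ 0 := by exact_mod_cast hgj₀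
  -- `u` is a multiple of `g`
  have hug : ∀ j, u j = u j₀ / g j₀ * g j := fun j => by
    have := helem (fun j => u j - u j₀ / g j₀ * g j) (fun i => by
      simp_rw [mul_sub, Finset.sum_sub_distrib, mul_left_comm _ (u j₀ / g j₀), ← Finset.mul_sum,
        hAu, hgAR]
      simp) (fun j hj => by simp [hj, hgsupp j hj]) ⟨j₀, huj₀, by field_simp; simp⟩
    have := congrFun this j
    simp only [Pi.zero_apply] at this
    linarith
  have hcirc : ∀ c : Fin n → ℤ, (∀ i, ∑ j, A i j * c j = 0) → Finset.univ.gcd c = 1 →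
      (∀ j, u j = 0 ↔ c j = 0) → IsCircuit A c := by
    intro c hAc hc1 hcs
    refine ⟨?_, fun h => hu0 (funext fun j => (hcs j).2 (congrFun h j)), hc1, ?_⟩
    · ext i
      exact hAc i
    · rintro ⟨v, hv, hv0, hsub, hns⟩
      obtain ⟨j, hj, hjv⟩ := Set.not_subset.1 hns
      have hvA : ∀ i, ∑ j, A i j * v j = 0 := fun i => congrFun (LinearMap.mem_ker.1 hv) i
      have := helem (fun j => v j) (fun i => by exact_mod_cast hvA i) (fun i hi => by
        by_contra hvi
        have hvi' : v i ≠ 0 := by exact_mod_cast hvi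
        exact hsub hvi' ((hcs i).1 hi)) ⟨j, fun h => hj ((hcs j).1 h), by simpa using hjv⟩
      exact hv0 (funext fun j => by simpa using congrFun this j)
  have hl0 : u j₀ / g j₀ ≠ 0 := div_ne_zero huj₀ hgj₀R
  set l := u j₀ / g j₀
  have hiff : ∀ j, u j = 0 ↔ g j = 0 := fun j => by
    rw [hug j]
    simp [hl0]
  -- As `u = l g`, whichever of `g`, `-g` is a positive multiple of `u` inherits its inequalities.
  rcases lt_or_gt_of_ne hl0 with hl | hl
  · refine ⟨-g, hcirc _ (fun i => by simp [hgA]) ?_ (by simpa using hiff), fun j hj => ?_, ?_⟩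
    · rw [← hg1]
      exact dvd_antisymm_of_normalize_eq Finset.normalize_gcd Finset.normalize_gcd
        (Finset.dvd_gcd fun j hj => (dvd_neg.1 (Finset.gcd_dvd (f := -g) hj)))
        (Finset.dvd_gcd fun j hj => (dvd_neg.2 (Finset.gcd_dvd (f := g) hj)))
    · have h1 := hpos j hj
      rw [hug j] at h1
      have h2 : (g j : ℝ) ≤ 0 := by
        by_contra! h
        nlinarith
      have h3 : g j ≤ 0 := by exact_mod_cast h2
      simpa using h3
    · simp_rw [hug, mul_left_comm _ l, ← Finset.mul_sum] at hωu
      have : 0 ≤ ∑ j, ω j * (g j : ℝ) := by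
        by_contra! h
        nlinarith
      simpa using this
  · refine ⟨g, hcirc _ hgA hg1 hiff, fun j hj => ?_, ?_⟩
    · have h1 := hpos j hj
      rw [hug j] at h1
      exact_mod_cast nonneg_of_mul_nonneg_right h1 hl
    · simp_rw [hug, mul_left_comm _ l, ← Finset.mul_sum] at hωu
      exact nonpos_of_mul_nonpos_right hωu hl

end CircuitIdeal

namespace CircuitIdeal

open MvPolynomial

variable {k : Type*} [Field k] {d n : ℕ}

/-! ### Monomial ideals and monomial primes -/

theorem mem_facePrime {σ : Finset (Fin n)} {f : MvPolynomial (Fin n) k} :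
    f ∈ facePrime k σ ↔ ∀ m ∈ f.support, ∃ j ∉ σ, m j ≠ 0 := by
  simp [facePrime, mem_ideal_span_X_image]

theorem X_mem_facePrime {σ : Finset (Fin n)} {j : Fin n} :
    (X j : MvPolynomial (Fin n) k) ∈ facePrime k σ ↔ j ∉ σ := by
  simp [mem_facePrime, support_X, Finsupp.single_apply]

theorem facePrime_le_facePrime {σ τ : Finset (Fin n)} :
    facePrime k σ ≤ facePrime k τ ↔ τ ⊆ σ := by
  refine ⟨fun h j hj => ?_, fun h => Ideal.span_mono (Set.image_mono fun j hj hjτ => hj (h hjτ))⟩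
  by_contra hjσ
  exact X_mem_facePrime.1 (h (X_mem_facePrime (k := k).2 hjσ)) hj

/-- It is the kernel of the substitution `x_j ↦ 0` for `j ∉ σ`, whose target is a domain. -/
theorem facePrime_isPrime (σ : Finset (Fin n)) : (facePrime k σ).IsPrime := by
  classical
  let φ : MvPolynomial (Fin n) k →ₐ[k] MvPolynomial (Fin n) k :=
    aeval fun j => if j ∈ σ then X j else 0
  have hφ : (Ideal.Quotient.mkₐ k (facePrime k σ)).comp φ = Ideal.Quotient.mkₐ k _ := by
    ext j
    by_cases hj : j ∈ σ
    · simp [φ, hj]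
    · simpa [φ, hj] using (Ideal.Quotient.eq_zero_iff_mem.2 (X_mem_facePrime.2 hj)).symm
  have : facePrime k σ = RingHom.ker φ := by
    refine le_antisymm (Ideal.span_le.2 ?_) fun f hf => ?_
    · rintro _ ⟨j, hj, rfl⟩
      have hj' : j ∉ σ := hj
      simp [φ, RingHom.mem_ker, hj']
    · have h := AlgHom.congr_fun hφ f
      rw [AlgHom.comp_apply, RingHom.mem_ker.1 hf, map_zero] at h
      exact Ideal.Quotient.eq_zero_iff_mem.1 h.symm
  rw [this]
  exact RingHom.ker_isPrime _

theorem IsMonomialIdeal.mem_iff {I : Ideal (MvPolynomial (Fin n) k)} (hI : IsMonomialIdeal I)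
    {f : MvPolynomial (Fin n) k} : f ∈ I ↔ ∀ m ∈ f.support, monomial m (1 : k) ∈ I := by
  obtain ⟨S, rfl⟩ := hI
  simp only [mem_ideal_span_monomial_image]
  refine forall₂_congr fun m _ => ?_
  classical
  simp [support_monomial]

theorem IsMonomialIdeal.le_facePrime_iff {I : Ideal (MvPolynomial (Fin n) k)}
    (hI : IsMonomialIdeal I) {σ : Finset (Fin n)} :
    I ≤ facePrime k σ ↔ ∀ m, monomial m (1 : k) ∈ I → ∃ j ∉ σ, m j ≠ 0 := by
  classical
  refine ⟨fun h m hm => mem_facePrime.1 (h hm) m (by simp [support_monomial]), fun h f hf => ?_⟩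
  exact mem_facePrime.2 fun m hm => h m (hI.mem_iff.1 hf m hm)

/-- Every prime containing a monomial ideal `I` contains a monomial prime containing `I`. -/
theorem IsMonomialIdeal.exists_facePrime_le {I Q : Ideal (MvPolynomial (Fin n) k)}
    (hI : IsMonomialIdeal I) (hQ : Q.IsPrime) (hIQ : I ≤ Q) :
    ∃ τ : Finset (Fin n), (∀ j, j ∈ τ ↔ (X j : MvPolynomial (Fin n) k) ∉ Q) ∧
      I ≤ facePrime k τ ∧ facePrime k τ ≤ Q := by
  classical
  refine ⟨Finset.univ.filter fun j => (X j : MvPolynomial (Fin n) k) ∉ Q, by simp, ?_, ?_⟩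
  · refine hI.le_facePrime_iff.2 fun m hm => ?_
    have := hIQ hm
    rw [monomial_eq, C_1, one_mul, Finsupp.prod, hQ.prod_mem_iff] at this
    obtain ⟨j, hj, hjQ⟩ := this
    exact ⟨j, by simpa using hQ.mem_of_pow_mem _ hjQ, Finsupp.mem_support_iff.1 hj⟩
  · refine Ideal.span_le.2 ?_
    rintro _ ⟨j, hj, rfl⟩
    simpa using hj

/-- Associated primes of monomial ideals are generated by variables. -/
theorem IsMonomialIdeal.associatedPrime_eq_facePrime {I Q : Ideal (MvPolynomial (Fin n) k)}
    (hI : IsMonomialIdeal I) (hQ : Q ∈ associatedPrimes _ (MvPolynomial (Fin n) k ⧸ I)) :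
    ∃ τ : Finset (Fin n), Q = facePrime k τ ∧ I ≤ facePrime k τ := by
  classical
  obtain ⟨hQp, x, hx⟩ := Submodule.isAssociatedPrime_iff.1 hQ
  obtain ⟨f, rfl⟩ := Ideal.Quotient.mk_surjective x
  have hmem : ∀ g, g ∈ Q ↔ g * f ∈ I := fun g => by
    rw [hx, Submodule.mem_colon_singleton, Submodule.mem_bot, ← Ideal.Quotient.eq_zero_iff_mem,
      map_mul]
    rfl
  obtain ⟨τ, hτ, hIτ, hτQ⟩ := hI.exists_facePrime_le hQp
    fun g hg => (hmem g).2 (I.mul_mem_right _ hg)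
  refine ⟨τ, le_antisymm (fun g hg => ?_) hτQ, hIτ⟩
  -- `x^e` is the product of the variables outside `Q`, so no power of it lies in `Q`.
  let e : Fin n →₀ ℕ := Finsupp.equivFunOnFinite.symm fun j => if j ∈ τ then 1 else 0
  have he : ∀ j, e j = if j ∈ τ then 1 else 0 := fun _ => rfl
  -- membership of monomials is monotone
  have hmono : ∀ a b : Fin n →₀ ℕ, a ≤ b → monomial a (1 : k) ∈ I → monomial b (1 : k) ∈ I := by
    intro a b hab ha
    have := I.mul_mem_left (monomial (b - a) 1) ha
    rwa [monomial_mul, tsub_add_cancel_of_le hab, one_mul] at this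
  have heQ : ∀ N : ℕ, monomial (N • e) (1 : k) ∉ Q := fun N h => by
    rw [monomial_eq, C_1, one_mul, Finsupp.prod, hQp.prod_mem_iff] at h
    obtain ⟨j, hj, hjQ⟩ := h
    refine (hτ j).1 ?_ (hQp.mem_of_pow_mem _ hjQ)
    by_contra hjτ
    simp [he, hjτ] at hj
  let bad : (Fin n →₀ ℕ) → Prop := fun v => ∃ N : ℕ, monomial (N • e + v) (1 : k) ∈ I
  -- A power of `x^e` carries all bad terms of `f` into `I`. Some good term remains, since that
  -- power does not annihilate `f` modulo `I`.
  let f₁ : MvPolynomial (Fin n) k := ∑ v ∈ f.support with ¬ bad v, monomial v (f.coeff v)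
  let f₂ : MvPolynomial (Fin n) k := ∑ v ∈ f.support with bad v, monomial v (f.coeff v)
  have hf : f₂ + f₁ = f := by
    rw [Finset.sum_filter_add_sum_filter_not, ← f.as_sum]
  obtain ⟨N, hN⟩ : ∃ N : ℕ, monomial (N • e) 1 * f₂ ∈ I := by
    choose! M hM using fun v (hv : bad v) => hv
    refine ⟨∑ v ∈ f.support, M v, ?_⟩
    rw [Finset.mul_sum]
    refine I.sum_mem fun v hv => ?_
    obtain ⟨hv1, hv2⟩ := Finset.mem_filter.1 hv
    have hle : M v ≤ ∑ v ∈ f.support, M v := Finset.single_le_sum (fun _ _ => Nat.zero_le _) hv1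
    have h1 := hmono _ ((∑ v ∈ f.support, M v) • e + v) (by gcongr) (hM v hv2)
    have h2 := I.mul_mem_left (C (f.coeff v)) h1
    rwa [C_mul_monomial, mul_one, ← one_mul (f.coeff v), ← monomial_mul] at h2
  have hf₁ : f₁ ≠ 0 := fun h => heQ N ((hmem _).2 (by rwa [← hf, h, add_zero]))
  have hcoeff : ∀ v, f₁.coeff v ≠ 0 → ¬ bad v := fun v hv hb => hv (by
    simp only [f₁, coeff_sum, coeff_monomial]
    refine Finset.sum_eq_zero fun w hw => if_neg ?_
    rintro rfl
    exact (Finset.mem_filter.1 hw).2 hb)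
  by_contra hgτ
  -- remove the terms of `g` lying in the face ideal
  let g₁ : MvPolynomial (Fin n) k := ∑ v ∈ g.support with ∀ j, v j ≠ 0 → j ∈ τ,
    monomial v (g.coeff v)
  let g₂ : MvPolynomial (Fin n) k := ∑ v ∈ g.support with ¬ ∀ j, v j ≠ 0 → j ∈ τ,
    monomial v (g.coeff v)
  have hgs : g₁ + g₂ = g := by
    rw [Finset.sum_filter_add_sum_filter_not, ← g.as_sum]
  have hg₂ : g₂ ∈ facePrime k τ := Ideal.sum_mem _ fun v hv => mem_facePrime.2 fun m hm => by
    obtain ⟨_, hv2⟩ := Finset.mem_filter.1 hv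
    obtain rfl : m = v := Finset.mem_singleton.1 (support_monomial_subset hm)
    push Not at hv2
    exact hv2.imp fun j h => ⟨h.2, h.1⟩
  have hg₁ : g₁ ≠ 0 := fun h => hgτ (by rwa [← hgs, h, zero_add])
  have hg₁supp : ∀ v, g₁.coeff v ≠ 0 → ∀ j, v j ≠ 0 → j ∈ τ := fun v hv => by
    by_contra hb
    refine hv ?_
    simp only [g₁, coeff_sum, coeff_monomial]
    refine Finset.sum_eq_zero fun w hw => if_neg ?_
    rintro rfl
    exact hb (Finset.mem_filter.1 hw).2
  have hg₁Q : g₁ ∈ Q := by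
    have := Q.sub_mem hg (hτQ hg₂)
    rwa [← hgs, add_sub_cancel_right] at this
  have hprod : monomial (N • e) 1 * (g₁ * f₁) ∈ I := by
    have h1 := I.mul_mem_left (monomial (N • e) 1) ((hmem _).1 hg₁Q)
    have h2 := I.mul_mem_left g₁ hN
    have h3 := I.sub_mem h1 h2
    have h4 : monomial (N • e) 1 * (g₁ * f) - g₁ * (monomial (N • e) 1 * f₂) =
        monomial (N • e) 1 * (g₁ * f₁) := by
      rw [← hf]
      ring
    rwa [h4] at h3
  -- The leading exponent `a + v` of `g₁ * f₁` cannot cancel. As `a` is supported in `τ`, a multiple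
  -- of `e` dominates it, which would make `v` bad.
  let ord : MonomialOrder (Fin n) := MonomialOrder.lex
  set a := ord.degree g₁
  set v := ord.degree f₁
  have hlead : (g₁ * f₁).coeff (a + v) ≠ 0 := by
    rw [← ord.degree_mul hg₁ hf₁]
    exact ord.coeff_degree_ne_zero_iff.2 (mul_ne_zero hg₁ hf₁)
  have h5 : monomial (N • e + (a + v)) (1 : k) ∈ I := hI.mem_iff.1 hprod _ (by
    rw [mem_support_iff, coeff_monomial_mul, one_mul]
    exact hlead)
  have ha : a ≤ a.degree • e := fun j => by
    by_cases hj : a j = 0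
    · simp [hj]
    · have := hg₁supp a (ord.coeff_degree_ne_zero_iff.2 hg₁) j hj
      simpa [he, this] using Finsupp.le_degree j a
  refine hcoeff v (ord.coeff_degree_ne_zero_iff.2 hf₁) ⟨N + a.degree, hmono _ _ ?_ h5⟩
  rw [add_smul, ← add_assoc]
  gcongr

/-! ### Initial forms and weights of binomials -/

theorem coeff_initialForm (ω : Fin n → ℝ) (f : MvPolynomial (Fin n) k) {u : Fin n →₀ ℕ}
    (hu : ∀ v ∈ f.support, Finsupp.weight ω v ≤ Finsupp.weight ω u) :
    (initialForm ω f).coeff u = f.coeff u := by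
  classical
  simp only [initialForm, coeff_sum, coeff_monomial]
  rw [Finset.sum_ite_eq']
  split_ifs with h
  · rfl
  · by_contra hne
    exact h (Finset.mem_filter.2 ⟨mem_support_iff.2 (Ne.symm hne), hu⟩)

theorem posPart_apply (u : Fin n → ℤ) (j : Fin n) : posPart u j = (u j).toNat := rfl

theorem posPart_sub_posPart_neg (u : Fin n → ℤ) (j : Fin n) :
    (posPart u j : ℤ) - posPart (-u) j = u j := by
  simp only [posPart_apply, Pi.neg_apply]
  omega

theorem posPart_ne_posPart_neg {u : Fin n → ℤ} (hu : u ≠ 0) : posPart u ≠ posPart (-u) :=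
  fun h => hu (funext fun j => by
    rw [← posPart_sub_posPart_neg u j, h, sub_self, Pi.zero_apply])

theorem weight_eq_sum (ω : Fin n → ℝ) (v : Fin n →₀ ℕ) :
    Finsupp.weight ω v = ∑ j, (v j : ℝ) * ω j := by
  simp [Finsupp.weight_apply, Finsupp.sum_fintype]

theorem weight_posPart_sub (ω : Fin n → ℝ) (u : Fin n → ℤ) :
    Finsupp.weight ω (posPart u) - Finsupp.weight ω (posPart (-u)) = ∑ j, ω j * (u j : ℝ) := by
  rw [weight_eq_sum, weight_eq_sum, ← Finset.sum_sub_distrib]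
  refine Finset.sum_congr rfl fun j _ => ?_
  have : ((posPart u j : ℝ)) - posPart (-u) j = u j := by
    exact_mod_cast posPart_sub_posPart_neg u j
  rw [← this]
  ring

/-- If the initial ideal is monomial, then it contains a monomial of maximal weight of every
binomial of the ideal, even if both monomials have the same weight. -/
theorem monomial_mem_initialIdeal {ω : Fin n → ℝ} {I : Ideal (MvPolynomial (Fin n) k)}
    (hI : IsMonomialIdeal (initialIdeal ω I)) {u : Fin n → ℤ} (hu : u ≠ 0)
    (huI : binomial k u ∈ I) (hω : ∑ j, ω j * (u j : ℝ) ≤ 0) :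
    monomial (posPart (-u)) (1 : k) ∈ initialIdeal ω I := by
  classical
  -- The exponent `u⁻` has maximal weight, so it survives in the initial form, and a monomial ideal
  -- contains each term of its elements.
  refine hI.mem_iff.1 (Ideal.subset_span ⟨_, huI, rfl⟩) _ ?_
  rw [mem_support_iff, coeff_initialForm]
  · simp [binomial, coeff_monomial, posPart_ne_posPart_neg hu]
  · intro v hv
    have hle : Finsupp.weight ω (posPart u) ≤ Finsupp.weight ω (posPart (-u)) := by
      linarith [weight_posPart_sub ω u]
    rw [mem_support_iff, binomial, coeff_sub, coeff_monomial, coeff_monomial] at hv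
    split_ifs at hv with h1 h2 h2
    · exact (h1 ▸ hle)
    · exact (h1 ▸ hle)
    · exact h2 ▸ le_rfl
    · simp at hv

/-! ### The `A`-grading and the parametrization of a face -/

/-- The `A`-degree of an exponent vector. -/
def expDegree (A : Matrix (Fin d) (Fin n) ℤ) (v : Fin n →₀ ℕ) : Fin d → ℤ :=
  A.mulVec fun j => (v j : ℤ)

theorem expDegree_posPart {A : Matrix (Fin d) (Fin n) ℤ} {u : Fin n → ℤ} (hu : u ∈ lattice A) :
    expDegree A (posPart u) = expDegree A (posPart (-u)) := by
  rw [← sub_eq_zero, expDegree, expDegree, ← Matrix.mulVec_sub]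
  refine Eq.trans (congrArg A.mulVec (funext fun j => ?_)) (LinearMap.mem_ker.1 hu)
  exact posPart_sub_posPart_neg u j

/-- The restriction of the `A`-graded parametrization to the monomials supported in `σ`. -/
noncomputable def faceHom (k : Type*) [Field k] (A : Matrix (Fin d) (Fin n) ℤ)
    (σ : Finset (Fin n)) : MvPolynomial (Fin n) k →ₐ[k] AddMonoidAlgebra k (Fin d → ℤ) :=
  aeval fun j => if j ∈ σ then AddMonoidAlgebra.single (fun i => A i j) 1 else 0

open Classical in
theorem faceHom_monomial (A : Matrix (Fin d) (Fin n) ℤ) (σ : Finset (Fin n)) (v : Fin n →₀ ℕ)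
    (a : k) : faceHom k A σ (monomial v a) =
      if ∀ j, v j ≠ 0 → j ∈ σ then AddMonoidAlgebra.single (expDegree A v) a else 0 := by
  rw [faceHom, aeval_monomial]
  split_ifs with h
  · have h1 : (v.prod fun j e => (if j ∈ σ then
        (AddMonoidAlgebra.single (fun i => A i j) 1 : AddMonoidAlgebra k (Fin d → ℤ)) else 0) ^ e) =
        AddMonoidAlgebra.single (expDegree A v) 1 := by
      rw [Finsupp.prod_fintype _ _ (by simp)]
      have h2 : ∀ j, (if j ∈ σ then (AddMonoidAlgebra.single (fun i => A i j) 1 :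
          AddMonoidAlgebra k (Fin d → ℤ)) else 0) ^ v j =
          AddMonoidAlgebra.single (v j • fun i => A i j) 1 := fun j => by
        by_cases hj : v j = 0
        · simp [hj, AddMonoidAlgebra.one_def]
        · rw [if_pos (h j hj), AddMonoidAlgebra.single_pow, one_pow]
      have h3 : ∀ (s : Finset (Fin n)) (g : Fin n → Fin d → ℤ),
          ∏ j ∈ s, (AddMonoidAlgebra.single (g j) 1 : AddMonoidAlgebra k (Fin d → ℤ)) =
            AddMonoidAlgebra.single (∑ j ∈ s, g j) 1 := fun s g => by
        induction s using Finset.induction_on with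
        | empty => simp [AddMonoidAlgebra.one_def]
        | insert j s hj ih =>
          rw [Finset.prod_insert hj, Finset.sum_insert hj, ih, AddMonoidAlgebra.single_mul_single,
            one_mul]
      rw [Finset.prod_congr rfl fun j _ => h2 j, h3]
      congr 1
      ext i
      simp [expDegree, Matrix.mulVec, dotProduct, mul_comm]
    rw [h1, ← Algebra.smul_def, AddMonoidAlgebra.smul_single, smul_eq_mul, mul_one]
  · push Not at h
    obtain ⟨j, hj, hjσ⟩ := h
    rw [Finsupp.prod, Finset.prod_eq_zero (Finsupp.mem_support_iff.2 hj), mul_zero]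
    rw [if_neg hjσ, zero_pow hj]

theorem faceHom_univ_eq_zero {A : Matrix (Fin d) (Fin n) ℤ} {f : MvPolynomial (Fin n) k}
    (hf : f ∈ toricIdeal k A) : faceHom k A Finset.univ f = 0 := by
  have : toricIdeal k A ≤ RingHom.ker (faceHom k A Finset.univ) := by
    refine Ideal.span_le.2 ?_
    rintro _ ⟨u, hu, rfl⟩
    rw [SetLike.mem_coe, RingHom.mem_ker, binomial, map_sub, faceHom_monomial, faceHom_monomial,
      expDegree_posPart hu]
    simp
  exact this hf

/-- A vector `c` certifying a face `σ` bounds weights from below in terms of degrees, with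
equality for exponents supported in `σ`. -/
theorem expDegree_le_weight {A : Matrix (Fin d) (Fin n) ℤ} {ω : Fin n → ℝ} {σ : Finset (Fin n)}
    {c : Fin d → ℝ} (hc : ∀ j, (j ∈ σ → ∑ i, (A i j : ℝ) * c i = ω j) ∧
      (j ∉ σ → ∑ i, (A i j : ℝ) * c i < ω j)) (v : Fin n →₀ ℕ) :
    ∑ i, (expDegree A v i : ℝ) * c i ≤ Finsupp.weight ω v ∧
      (∑ i, (expDegree A v i : ℝ) * c i = Finsupp.weight ω v ↔ ∀ j, v j ≠ 0 → j ∈ σ) := by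
  have h1 : ∑ i, (expDegree A v i : ℝ) * c i = ∑ j, (v j : ℝ) * ∑ i, (A i j : ℝ) * c i := by
    simp only [expDegree, Matrix.mulVec, dotProduct]
    push_cast
    simp_rw [Finset.sum_mul, Finset.mul_sum]
    rw [Finset.sum_comm]
    exact Finset.sum_congr rfl fun _ _ => Finset.sum_congr rfl fun _ _ => by ring
  have h2 : ∀ j ∈ Finset.univ, (v j : ℝ) * ∑ i, (A i j : ℝ) * c i ≤ (v j : ℝ) * ω j :=
    fun j _ => by
      refine mul_le_mul_of_nonneg_left ?_ (Nat.cast_nonneg _)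
      by_cases hj : j ∈ σ
      · exact ((hc j).1 hj).le
      · exact ((hc j).2 hj).le
  rw [h1, weight_eq_sum]
  refine ⟨Finset.sum_le_sum h2, (Finset.sum_eq_sum_iff_of_le h2).trans ⟨fun h j hj => ?_,
    fun h j _ => ?_⟩⟩
  · by_contra hjσ
    have h3 := mul_left_cancel₀ (Nat.cast_ne_zero.2 hj) (h j (Finset.mem_univ _))
    exact ((hc j).2 hjσ).ne h3
  · by_cases hj : v j = 0
    · simp [hj]
    · rw [(hc j).1 (h j hj)]

/-- Terms supported in `σ` have the least weight possible in their `A`-degree, while initial forms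
collect terms of greatest weight. -/
theorem faceHom_eq_zero_of_mem_initialIdeal {A : Matrix (Fin d) (Fin n) ℤ} {ω : Fin n → ℝ}
    {σ : Finset (Fin n)} (hσ : σ ∈ regularTriangulation A ω) {g : MvPolynomial (Fin n) k}
    (hg : g ∈ initialIdeal ω (toricIdeal k A)) : faceHom k A σ g = 0 := by
  classical
  obtain ⟨c, hc⟩ := hσ
  have : initialIdeal ω (toricIdeal k A) ≤ RingHom.ker (faceHom k A σ) := by
    refine Ideal.span_le.2 ?_
    rintro _ ⟨f, hf, rfl⟩
    rw [SetLike.mem_coe, RingHom.mem_ker]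
    have h0 := faceHom_univ_eq_zero hf
    rw [f.as_sum, map_sum] at h0
    rw [initialForm, map_sum]
    simp_rw [faceHom_monomial] at h0 ⊢
    simp only [Finset.mem_univ, implies_true, if_true] at h0
    ext b
    have h0b := congrArg (fun p : AddMonoidAlgebra k (Fin d → ℤ) => p.coeff b) h0
    simp only [AddMonoidAlgebra.coeff_sum, Finsupp.finsetSum_apply, AddMonoidAlgebra.coeff_single,
      AddMonoidAlgebra.coeff_zero, Finsupp.coe_zero, Pi.zero_apply] at h0b ⊢
    have hite : ∀ u : Fin n →₀ ℕ, (if ∀ j, u j ≠ 0 → j ∈ σ then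
        AddMonoidAlgebra.single (expDegree A u) (f.coeff u) else 0).coeff b =
        if (∀ j, u j ≠ 0 → j ∈ σ) ∧ expDegree A u = b then f.coeff u else 0 := fun u => by
      by_cases h : ∀ j, u j ≠ 0 → j ∈ σ
      · rw [if_pos h, AddMonoidAlgebra.coeff_single, Finsupp.single_apply]
        exact if_congr (by tauto) rfl rfl
      · rw [if_neg h, if_neg fun h' => h h'.1]
        rfl
    simp_rw [hite]
    simp_rw [Finsupp.single_apply] at h0b
    rw [← Finset.sum_filter, Finset.filter_filter]
    rw [← Finset.sum_filter] at h0b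
    -- If such a `u₀` exists, its weight is both minimal in degree `b` and maximal in `f`. All
    -- degree-`b` terms of `f` then have this weight and are supported in `σ`, so the coefficient
    -- agrees with that of the full parametrization, which is zero. Otherwise nothing contributes.
    by_cases hex : ∃ u₀ ∈ f.support, (∀ v ∈ f.support, Finsupp.weight ω v ≤ Finsupp.weight ω u₀) ∧
        (∀ j, u₀ j ≠ 0 → j ∈ σ) ∧ expDegree A u₀ = b
    · obtain ⟨u₀, hu₀, hmax, hsupp, rfl⟩ := hex
      rw [← h0b]
      refine Finset.sum_congr (Finset.filter_congr fun u hu => ⟨fun h => h.2.2, fun h => ?_⟩)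
        fun _ _ => rfl
      have h1 := (expDegree_le_weight hc u₀).2.2 hsupp
      have h2 := expDegree_le_weight hc u
      rw [h] at h2
      have h3 := le_antisymm h2.1 (h1 ▸ hmax u hu)
      exact ⟨fun v hv => (hmax v hv).trans (by rw [← h1, h3]), h2.2.1 h3, h⟩
    · push Not at hex
      rw [Finset.filter_eq_empty_iff.2 fun u hu h => hex u hu h.1 h.2.1 h.2.2, Finset.sum_empty]
  exact this hg

end CircuitIdeal

namespace CircuitIdeal

open MvPolynomial

variable {k : Type*} [Field k] {d n : ℕ} {A : Matrix (Fin d) (Fin n) ℤ} {ω : Fin n → ℝ}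

/-! ### Faces and monomials of the initial ideals -/

theorem circuitIdeal_le_toricIdeal : circuitIdeal k A ≤ toricIdeal k A :=
  Ideal.span_mono (Set.image_mono fun _ hc => hc.1)

theorem monomial_notMem_initialIdeal {σ : Finset (Fin n)} (hσ : σ ∈ regularTriangulation A ω)
    {m : Fin n →₀ ℕ} (hm : ∀ j, m j ≠ 0 → j ∈ σ) :
    monomial m (1 : k) ∉ initialIdeal ω (toricIdeal k A) := fun h => by
  have := faceHom_eq_zero_of_mem_initialIdeal hσ h
  rw [faceHom_monomial, if_pos hm] at this
  simp at this

/-- The faces of the regular triangulation are the sets whose monomial primes contain the initial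
ideal of the circuit ideal. -/
theorem initialIdeal_le_facePrime_iff
    (hI : IsMonomialIdeal (initialIdeal ω (circuitIdeal k A))) {σ : Finset (Fin n)} :
    initialIdeal ω (circuitIdeal k A) ≤ facePrime k σ ↔ σ ∈ regularTriangulation A ω := by
  rw [hI.le_facePrime_iff]
  refine ⟨fun h => ?_, fun hσ m hm => ?_⟩
  · by_contra hσ
    -- `c⁻` is supported in `σ`, so `x^{c⁻}` avoids `P_σ`.
    obtain ⟨c, hc, hpos, hω⟩ := exists_circuit_of_not_face A ω hσ
    obtain ⟨j, hj, hne⟩ := h _ (monomial_mem_initialIdeal hI hc.2.1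
      (Ideal.subset_span ⟨c, hc, rfl⟩) hω)
    have := hpos j hj
    rw [posPart_apply, Pi.neg_apply] at hne
    omega
  · by_contra! hb
    refine monomial_notMem_initialIdeal hσ (fun j hj => ?_)
      (Ideal.span_mono (Set.image_mono fun f hf => circuitIdeal_le_toricIdeal hf) hm)
    by_contra hjσ
    exact hj (hb j hjσ)

/-! ### Cardinality of maximal faces -/

/-- The columns indexed by a face are linearly independent. -/
theorem eq_zero_of_support_subset_face
    (hI : IsMonomialIdeal (initialIdeal ω (toricIdeal k A))) {σ : Finset (Fin n)}
    (hσ : σ ∈ regularTriangulation A ω) {u : Fin n → ℤ} (hu : u ∈ lattice A)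
    (hsupp : ∀ j, u j ≠ 0 → j ∈ σ) : u = 0 := by
  by_contra hu0
  have h1 : ∀ j, posPart u j ≠ 0 → j ∈ σ := fun j hj => hsupp j fun h => hj (by
    simp [posPart_apply, h])
  have h2 : ∀ j, posPart (-u) j ≠ 0 → j ∈ σ := fun j hj => hsupp j fun h => hj (by
    simp [posPart_apply, h])
  -- On `σ` the `A`-degree determines the weight, so `ω · u = 0`; the monomial hypothesis applies
  -- even to this tie.
  refine monomial_notMem_initialIdeal hσ h2
    (monomial_mem_initialIdeal hI hu0 (Ideal.subset_span ⟨u, hu, rfl⟩) ?_)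
  obtain ⟨c, hc⟩ := hσ
  rw [← weight_posPart_sub, ← ((expDegree_le_weight hc _).2.2 h1),
    ← ((expDegree_le_weight hc _).2.2 h2), expDegree_posPart hu, sub_self]

theorem card_le_of_face (hI : IsMonomialIdeal (initialIdeal ω (toricIdeal k A)))
    {σ : Finset (Fin n)} (hσ : σ ∈ regularTriangulation A ω) : σ.card ≤ d := by
  classical
  let E : (σ → ℤ) →ₗ[ℤ] (Fin n → ℤ) := Function.ExtendByZero.linearMap ℤ Subtype.val
  have hE1 : ∀ v (j : σ), E v j = v j := fun v j => by
    simp [E]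
  have hE2 : ∀ v j, j ∉ σ → E v j = 0 := fun v j hj => by
    have : ¬ ∃ a : σ, a.val = j := by simpa using hj
    simp [E, Function.extend_apply' _ _ _ this]
  have hinj : Function.Injective (A.mulVecLin ∘ₗ E) := by
    rw [← LinearMap.ker_eq_bot, LinearMap.ker_eq_bot']
    intro v hv
    have := eq_zero_of_support_subset_face hI hσ (u := E v) hv fun j hj => by
      by_contra h
      exact hj (hE2 v j h)
    ext j
    rw [← hE1 v j, this]
    rfl
  simpa using LinearMap.finrank_le_finrank_of_injective hinj

/-- The rows of a matrix of full row rank are linearly independent over the reals. -/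
theorem eq_zero_of_rank_eq (hrank : A.rank = d) {c : Fin d → ℝ}
    (hc : ∀ j, ∑ i, (A i j : ℝ) * c i = 0) : c = 0 := by
  by_contra hc0
  obtain ⟨e, he0, he, -⟩ := exists_int_solution (fun j i => A i j) c hc0 hc
  let g : (Fin d → ℤ) →ₗ[ℤ] ℤ := ∑ i, e i • LinearMap.proj i
  have hg : ∀ x, g x = ∑ i, e i * x i := fun x => by simp [g]
  obtain ⟨i₀, hi₀⟩ : ∃ i, e i ≠ 0 := by
    by_contra! h
    exact he0 (funext h)
  -- Pairing with `e` kills the column lattice, whose rank is then at most `d - 1`.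
  have hle : LinearMap.range A.mulVecLin ≤ LinearMap.ker g := by
    rintro _ ⟨v, rfl⟩
    rw [LinearMap.mem_ker, hg]
    simp only [Matrix.mulVecLin_apply, Matrix.mulVec, dotProduct, Finset.mul_sum]
    rw [Finset.sum_comm]
    refine Finset.sum_eq_zero fun j _ => ?_
    have := he j
    calc ∑ i, e i * (A i j * v j) = (∑ i, A i j * e i) * v j := by
          rw [Finset.sum_mul]
          exact Finset.sum_congr rfl fun _ _ => by ring
      _ = 0 := by rw [this, zero_mul]
  have h1 : Module.finrank ℤ (LinearMap.range A.mulVecLin) ≤ Module.finrank ℤ (LinearMap.ker g) :=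
    Submodule.finrank_mono hle
  have h2 := Submodule.finrank_quotient_add_finrank (LinearMap.ker g)
  rw [g.quotKerEquivRange.finrank_eq] at h2
  have h3 : Module.finrank ℤ (LinearMap.range g) ≠ 0 := fun h => by
    have := Submodule.finrank_eq_zero.1 h
    rw [LinearMap.range_eq_bot] at this
    have h4 := LinearMap.congr_fun this (Pi.single i₀ 1)
    rw [hg] at h4
    simp [Pi.single_apply, hi₀] at h4
  have h5 : Module.finrank ℤ (LinearMap.range A.mulVecLin) = d := hrank
  rw [Module.finrank_fin_fun] at h2
  omega

/-- If `σ` has fewer than `d` elements, the certificate `c` can move along a direction orthogonal to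
the columns of `σ` until another inequality becomes tight; full rank ensures one does. -/
theorem card_eq_of_maximal_face (hrank : A.rank = d)
    (hI : IsMonomialIdeal (initialIdeal ω (toricIdeal k A)))
    {σ : Finset (Fin n)} (hσ : Maximal (fun τ => τ ∈ regularTriangulation A ω) σ) :
    σ.card = d := by
  classical
  refine (card_le_of_face hI hσ.1).antisymm ?_
  by_contra! hlt
  obtain ⟨c, hc⟩ := hσ.1
  let L : (Fin d → ℝ) →ₗ[ℝ] (σ → ℝ) :=
    LinearMap.pi fun j => ∑ i, (A i j : ℝ) • LinearMap.proj i
  have hker : LinearMap.ker L ≠ ⊥ := LinearMap.ker_ne_bot_of_finrank_lt (by simpa using hlt)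
  obtain ⟨e, heL, he0⟩ := Submodule.exists_mem_ne_zero_of_ne_bot hker
  have heσ : ∀ j ∈ σ, ∑ i, (A i j : ℝ) * e i = 0 := fun j hj => by
    simpa [L] using congrFun (LinearMap.mem_ker.1 heL) ⟨j, hj⟩
  obtain ⟨v, hvσ, j₀, hj₀⟩ : ∃ v : Fin d → ℝ, (∀ j ∈ σ, ∑ i, (A i j : ℝ) * v i = 0) ∧
      ∃ j, 0 < ∑ i, (A i j : ℝ) * v i := by
    obtain ⟨j, hj⟩ : ∃ j, ∑ i, (A i j : ℝ) * e i ≠ 0 := by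
      by_contra! h
      exact he0 (eq_zero_of_rank_eq hrank h)
    rcases lt_or_gt_of_ne hj with h | h
    · exact ⟨-e, fun j hj => by simp [heσ j hj], j, by simpa using h⟩
    · exact ⟨e, heσ, j, h⟩
  set a : Fin n → ℝ := fun j => ∑ i, (A i j : ℝ) * c i with ha
  set b : Fin n → ℝ := fun j => ∑ i, (A i j : ℝ) * v i with hb
  obtain ⟨j₁, hj₁, hmin⟩ := (Finset.univ.filter fun j => 0 < b j).exists_min_image
    (fun j => (ω j - a j) / b j) ⟨j₀, by simpa using hj₀⟩
  simp only [Finset.mem_filter, Finset.mem_univ, true_and] at hj₁ hmin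
  have hle : ∀ j, a j ≤ ω j := fun j => by
    by_cases hj : j ∈ σ
    · exact ((hc j).1 hj).le
    · exact ((hc j).2 hj).le
  -- The first time a further constraint becomes tight; the tight indices at `c + t • v` form the
  -- larger face `τ`.
  set t := (ω j₁ - a j₁) / b j₁ with ht
  have ht0 : 0 ≤ t := div_nonneg (by linarith [hle j₁]) hj₁.le
  have hj₁σ : j₁ ∉ σ := fun h => hj₁.ne' (hvσ j₁ h)
  have hsum : ∀ j, ∑ i, (A i j : ℝ) * (c + t • v) i = a j + t * b j := fun j => by
    simp only [ha, hb, Pi.add_apply, Pi.smul_apply, smul_eq_mul, Finset.mul_sum, mul_add,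
      Finset.sum_add_distrib]
    congr 1
    exact Finset.sum_congr rfl fun _ _ => by ring
  have hle' : ∀ j, a j + t * b j ≤ ω j := fun j => by
    rcases lt_or_ge 0 (b j) with h | h
    · have := hmin j h
      rw [le_div_iff₀ h] at this
      linarith
    · nlinarith [hle j]
  let τ : Finset (Fin n) := Finset.univ.filter fun j => a j + t * b j = ω j
  have hτ : τ ∈ regularTriangulation A ω := ⟨c + t • v, fun j => by
    rw [hsum]
    exact ⟨fun hj => (Finset.mem_filter.1 hj).2, fun hj => lt_of_le_of_ne (hle' j) fun h =>
      hj (Finset.mem_filter.2 ⟨Finset.mem_univ _, h⟩)⟩⟩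
  have hστ : σ ≤ τ := fun j hj => Finset.mem_filter.2 ⟨Finset.mem_univ _, by
    have h1 : a j = ω j := (hc j).1 hj
    have h2 : b j = 0 := hvσ j hj
    rw [h1, h2, mul_zero, add_zero]⟩
  refine hj₁σ (hσ.2 hτ hστ (Finset.mem_filter.2 ⟨Finset.mem_univ _, ?_⟩))
  rw [ht, div_mul_cancel₀ _ hj₁.ne']
  ring

/-! ### Quotients by monomial primes and minimal primes -/

/-- A permutation of the variables carries one prime to the other, so no dimension has to be
computed. -/
theorem ringKrullDim_quotient_facePrime_eq {σ τ : Finset (Fin n)} (h : σ.card = τ.card) :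
    ringKrullDim (MvPolynomial (Fin n) k ⧸ facePrime k σ) =
      ringKrullDim (MvPolynomial (Fin n) k ⧸ facePrime k τ) := by
  classical
  obtain ⟨π, hπ⟩ : ∃ π : Equiv.Perm (Fin n), ∀ j, π j ∈ τ ↔ j ∈ σ := by
    let e : {j // j ∈ σ} ≃ {j // j ∈ τ} := Finset.equivOfCardEq h
    exact ⟨e.extendSubtype, fun j => ⟨fun hj => by
      by_contra hjσ
      exact e.extendSubtype_not_mem j hjσ hj, fun hj => e.extendSubtype_mem j hj⟩⟩
  refine ringKrullDim_eq_of_ringEquiv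
    (Ideal.quotientEquiv _ _ (renameEquiv k π).toRingEquiv ?_)
  rw [facePrime, facePrime, Ideal.map_span, Set.image_image]
  congr 1
  ext f
  constructor
  · rintro ⟨j, hj, rfl⟩
    exact ⟨π.symm j, fun h => hj (by simpa using (hπ _).2 h), by simp⟩
  · rintro ⟨j, hj, rfl⟩
    exact ⟨π j, fun h => hj ((hπ j).1 h), by simp⟩

theorem facePrime_mem_minimalPrimes_iff
    (hI : IsMonomialIdeal (initialIdeal ω (circuitIdeal k A))) {σ : Finset (Fin n)} :
    facePrime k σ ∈ (initialIdeal ω (circuitIdeal k A)).minimalPrimes ↔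
      Maximal (fun τ => τ ∈ regularTriangulation A ω) σ := by
  refine ⟨fun h => ⟨(initialIdeal_le_facePrime_iff hI).1 h.1.2, fun τ hτ hστ => ?_⟩,
    fun h => ⟨⟨facePrime_isPrime σ, (initialIdeal_le_facePrime_iff hI).2 h.1⟩, ?_⟩⟩
  · exact facePrime_le_facePrime.1 (h.2 ⟨facePrime_isPrime τ,
      (initialIdeal_le_facePrime_iff hI).2 hτ⟩ (facePrime_le_facePrime.2 hστ))
  · rintro Q ⟨hQ, hIQ⟩ hQσ
    obtain ⟨τ, -, hIτ, hτQ⟩ := hI.exists_facePrime_le hQ hIQ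
    have hτ := (initialIdeal_le_facePrime_iff hI).1 hIτ
    exact (facePrime_le_facePrime.2
      (h.2 hτ (facePrime_le_facePrime.1 (hτQ.trans hQσ)))).trans hτQ

theorem exists_eq_facePrime_of_mem_minimalPrimes {I Q : Ideal (MvPolynomial (Fin n) k)}
    (hI : IsMonomialIdeal I) (hQ : Q ∈ I.minimalPrimes) : ∃ σ, Q = facePrime k σ := by
  obtain ⟨τ, -, hIτ, hτQ⟩ := hI.exists_facePrime_le hQ.1.1 hQ.1.2
  exact ⟨τ, le_antisymm (hQ.2 ⟨facePrime_isPrime τ, hIτ⟩ hτQ) hτQ⟩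

end CircuitIdeal

theorem corollary3p5 {k : Type*} [Field k] [IsAlgClosed k] {d n : ℕ}
    (A : Matrix (Fin d) (Fin n) ℤ) (hrank : A.rank = d)
    (hpos : ∀ u ∈ CircuitIdeal.lattice A, (∀ j, 0 ≤ u j) → u = 0)
    (ω : Fin n → ℝ) (hω : CircuitIdeal.IsGeneric k A ω) :
    (∀ Q ∈ associatedPrimes (MvPolynomial (Fin n) k)
        (MvPolynomial (Fin n) k ⧸
          CircuitIdeal.initialIdeal ω (CircuitIdeal.circuitIdeal k A)),
      ∃ σ ∈ CircuitIdeal.regularTriangulation A ω, Q = CircuitIdeal.facePrime k σ) ∧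
    (∀ σ : Finset (Fin n),
      CircuitIdeal.facePrime k σ ∈
          (CircuitIdeal.initialIdeal ω (CircuitIdeal.circuitIdeal k A)).minimalPrimes ↔
        Maximal (fun τ => τ ∈ CircuitIdeal.regularTriangulation A ω) σ) ∧
    CircuitIdeal.IsEquidimensional
      (CircuitIdeal.initialIdeal ω (CircuitIdeal.circuitIdeal k A)) := by
  refine ⟨fun Q hQ => ?_, fun σ => CircuitIdeal.facePrime_mem_minimalPrimes_iff hω.2,
    fun P hP Q hQ => ?_⟩
  · obtain ⟨σ, rfl, hσ⟩ := hω.2.associatedPrime_eq_facePrime hQ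
    exact ⟨σ, (CircuitIdeal.initialIdeal_le_facePrime_iff hω.2).1 hσ, rfl⟩
  · obtain ⟨σ, rfl⟩ := CircuitIdeal.exists_eq_facePrime_of_mem_minimalPrimes hω.2 hP
    obtain ⟨τ, rfl⟩ := CircuitIdeal.exists_eq_facePrime_of_mem_minimalPrimes hω.2 hQ
    rw [CircuitIdeal.facePrime_mem_minimalPrimes_iff hω.2] at hP hQ
    exact CircuitIdeal.ringKrullDim_quotient_facePrime_eq
      ((CircuitIdeal.card_eq_of_maximal_face hrank hω.1 hP).trans
        (CircuitIdeal.card_eq_of_maximal_face hrank hω.1 hQ).symm)
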